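/- Let $\mathbb{X}$ be an arbitrary set and let $\mathcal{E} \subset \mathbb{R}$ be bounded (not necessarily closed). A random field on $\mathbb{X}$ valued in $\mathcal{E}$ is given by a probability measure $\mathbb{P}$ on the Borel $\sigma$-algebra of the product space $\Omega = \mathcal{E}^{\mathbb{X}}$, with $Z(x,\omega) = \omega(x)$, and its non-centered covariance is $(x,y) \mapsto \int_\Omega Z(x,\omega)\, Z(y,\omega)\, \mathbb{P}(\mathrm{d}\omega)$. For a positive integer $n$ and a real matrix $\Lambda \in \mathbb{R}^{n\times n}$, let $$\gamma(\Lambda,\mathcal{E}) = \inf\{ z \Lambda z^\top : z \in \mathcal{E}^n \} \in [-\infty,+\infty]$$ (with $z$ a row vector and $\inf \emptyset = +\infty$), and let $\langle A,B\rangle = \mathrm{tr}(AB^\top)$ for $A,B \in \mathbb{R}^{n\times n}$. A mapping $\rho : \mathbb{X}\times\mathbb{X} \to \mathbb{R}$ is the pointwise limit of a sequence of non-centered covariances of random fields on $\mathbb{X}$ valued in $\mathcal{E}$ if, and only if, it fulfills the following two conditions: 1. Symmetry: $\rho(x,y) = \rho(y,x)$ for all $x,y \in \mathbb{X}$. 2.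 Gap inequalities: for any positive integer $n$, any real symmetric matrix $\Lambda = [\lambda_{k\ell}]_{k,\ell=1}^n$ and any points $x_1,\ldots,x_n$ in $\mathbb{X}$, $$\langle \Lambda, R\rangle = \sum_{k=1}^n\sum_{\ell=1}^n \lambda_{k\ell}\,\rho(x_k,x_\ell) \ge \gamma(\Lambda,\mathcal{E}), \qquad \text{where } R = [\rho(x_k,x_\ell)]_{k,\ell=1}^n.$$ -/

import Mathlib

open MeasureTheory Filter
open scoped Topology Matrix

/-- The sample space `ℰ^𝕏` of a random field on `X` valued in `E`: the set of all its possible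
realizations `x ↦ ω x`. It is a separate type because its event space is the Borel σ-algebra of the
product topology, which for uncountable `X` is larger than the product σ-algebra that Mathlib puts
on the function type. -/
def SampleSpace (X : Type*) (E : Set ℝ) : Type _ := X → E

namespace SampleSpace

variable {X : Type*} {E : Set ℝ}

/-- The product topology, every factor `E` having the subspace topology of the real line. -/
instance instTopologicalSpace : TopologicalSpace (SampleSpace X E) :=
  inferInstanceAs (TopologicalSpace (X → E))

/-- The event space: the Borel subsets of the sample space. -/
instance instMeasurableSpace : MeasurableSpace (SampleSpace X E) := borel (SampleSpace X E)

instance instBorelSpace : BorelSpace (SampleSpace X E) := ⟨rfl⟩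

/-- The value `Z(x, ω) = ω(x)` at the point `x` of the realization `ω`. -/
def value (x : X) (ω : SampleSpace X E) : ℝ := (ω x : ℝ)

/-- Every `Z(x, ·)` is a random variable. -/
theorem measurable_value (x : X) : Measurable (value x : SampleSpace X E → ℝ) := by
  have h : Continuous (fun ω : X → E => ((ω x : E) : ℝ)) :=
    continuous_subtype_val.comp (continuous_apply x)
  have h' : Continuous (value x : SampleSpace X E → ℝ) := h
  exact h'.measurable

end SampleSpace

/-- `ρ` is the non-centered covariance of a (square integrable) random field on `X` valued in `E`:
for some probability measure on the sample space, `ρ(x, y)` is the expectation of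
`Z(x, ·) Z(y, ·)`. -/
def IsNoncenteredCovariance {X : Type*} (E : Set ℝ) (ρ : X → X → ℝ) : Prop :=
  ∃ P : Measure (SampleSpace X E), IsProbabilityMeasure P ∧
    (∀ x, MemLp (SampleSpace.value x) 2 P) ∧
    ∀ x y, ρ x y = ∫ ω, SampleSpace.value x ω * SampleSpace.value y ω ∂P

/-- The trace inner product `⟨A, B⟩ = tr(A Bᵀ)` of real square matrices. -/
def traceInner {n : ℕ} (A B : Matrix (Fin n) (Fin n) ℝ) : ℝ := (A * Bᵀ).trace

/-- The `γ`-gap of a real square matrix `L` on `E`, the infimum of `z L zᵀ` over the vectors `z`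
with all components in `E`. It is an extended real number: it is `-∞` when the values are not
bounded below, and `+∞` when there is no such vector. -/
noncomputable def gammaGap {n : ℕ} (L : Matrix (Fin n) (Fin n) ℝ) (E : Set ℝ) : EReal :=
  sInf {v : EReal | ∃ z : Fin n → ℝ, (∀ k, z k ∈ E) ∧ v = ((z ⬝ᵥ (L *ᵥ z) : ℝ) : EReal)}

/-! For a random field, the gap inequality holds pointwise in ω, so it survives integration
(`IsNoncenteredCovariance.le_sum`) and then pointwise limits. Conversely, `E` need not be compact,
so its values are rounded to a finite `F ⊆ E`, at the price of an error ε in products. At finitely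
many points, the matrices close to covariances of `F`-valued fields form a convex set containing
every `z zᵀ` with `z` in `E`; by Hahn–Banach the gap inequalities force `R` into its closure
(`mem_of_gap_inequalities`). Compactness of the probability measures on `F^X` then gives one field
that works for all points at once. Letting ε → 0 yields the sequence. -/

namespace SampleSpace

variable {X : Type*} {E F : Set ℝ}

theorem continuous_value (x : X) : Continuous (value x : SampleSpace X E → ℝ) := by
  have h : Continuous (fun ω : X → E => ((ω x : E) : ℝ)) :=
    continuous_subtype_val.comp (continuous_apply x)
  exact h

theorem continuous_value_mul_value (x y : X) :
    Continuous fun ω : SampleSpace X E => value x ω * value y ω :=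
  (continuous_value x).mul (continuous_value y)

instance instT2Space : T2Space (SampleSpace X E) :=
  inferInstanceAs (T2Space (X → E))

theorem compactSpace (hF : IsCompact F) : CompactSpace (SampleSpace X F) :=
  haveI : CompactSpace F := isCompact_iff_compactSpace.1 hF
  inferInstanceAs (CompactSpace (X → F))

/-- The inclusion of sample spaces induced by an inclusion of the sets of values. -/
def inclusion (h : F ⊆ E) (ω : SampleSpace X F) : SampleSpace X E :=
  fun x => Set.inclusion h (ω x)

theorem continuous_inclusion (h : F ⊆ E) :
    Continuous (inclusion h : SampleSpace X F → SampleSpace X E) := by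
  have h' : Continuous (fun (ω : X → F) (x : X) => Set.inclusion h (ω x)) :=
    continuous_pi fun x => (_root_.continuous_inclusion h).comp (continuous_apply x)
  exact h'

theorem memLp_value (hE : Bornology.IsBounded E) (P : Measure (SampleSpace X E))
    [IsFiniteMeasure P] (x : X) (p : ENNReal) : MemLp (value x) p P := by
  obtain ⟨C, hC⟩ := hE.exists_norm_le
  exact MemLp.of_bound (measurable_value x).aestronglyMeasurable C
    (Eventually.of_forall fun ω => hC _ (ω x).2)

theorem integrable_value_mul_value (hE : Bornology.IsBounded E) (P : Measure (SampleSpace X E))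
    [IsFiniteMeasure P] (x y : X) : Integrable (fun ω => value x ω * value y ω) P :=
  (memLp_value hE P x 2).integrable_mul (memLp_value hE P y 2)

/-- A non-centered covariance depends continuously on the probability measure. -/
theorem continuous_integral_value_mul_value (hE : Bornology.IsBounded E) (x y : X) :
    Continuous fun P : ProbabilityMeasure (SampleSpace X E) =>
      ∫ ω, value x ω * value y ω ∂(P : Measure (SampleSpace X E)) := by
  obtain ⟨C, hC⟩ := hE.exists_norm_le
  let f : BoundedContinuousFunction (SampleSpace X E) ℝ :=
    BoundedContinuousFunction.ofNormedAddCommGroup (fun ω => value x ω * value y ω)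
      (continuous_value_mul_value x y) (C * C) fun ω => by
        rw [norm_mul]
        exact mul_le_mul (hC _ (ω x).2) (hC _ (ω y).2) (norm_nonneg _)
          ((norm_nonneg _).trans (hC _ (ω x).2))
  exact ProbabilityMeasure.continuous_integral_boundedContinuousFunction f

/-- The matrices that differ by at most `ε` in every entry from the non-centered covariance matrix
at the points `x k` of some random field form a convex set. -/
theorem convex_setOf_near_covariance (hE : Bornology.IsBounded E) {n : ℕ} (x : Fin n → X) (ε : ℝ) :
    Convex ℝ {A : Fin n → Fin n → ℝ | ∃ P : ProbabilityMeasure (SampleSpace X E),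
      ∀ k l, |A k l - ∫ ω, value (x k) ω * value (x l) ω ∂(P : Measure (SampleSpace X E))| ≤ ε} := by
  rintro A ⟨P, hP⟩ B ⟨Q, hQ⟩ a b ha hb hab
  have hprob : IsProbabilityMeasure
      (ENNReal.ofReal a • (P : Measure (SampleSpace X E)) +
        ENNReal.ofReal b • (Q : Measure (SampleSpace X E))) := by
    constructor
    simp [← ENNReal.ofReal_add ha hb, hab]
  refine ⟨⟨_, hprob⟩, fun k l => ?_⟩
  have hIP := integrable_value_mul_value hE (P : Measure (SampleSpace X E)) (x k) (x l)
  have hIQ := integrable_value_mul_value hE (Q : Measure (SampleSpace X E)) (x k) (x l)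
  rw [ProbabilityMeasure.coe_mk, integral_add_measure (hIP.smul_measure ENNReal.ofReal_ne_top)
    (hIQ.smul_measure ENNReal.ofReal_ne_top), integral_smul_measure, integral_smul_measure,
    ENNReal.toReal_ofReal ha, ENNReal.toReal_ofReal hb]
  have h1 := abs_le.1 (hP k l)
  have h2 := abs_le.1 (hQ k l)
  simp only [Pi.add_apply, Pi.smul_apply, smul_eq_mul]
  rw [abs_le]
  constructor <;> nlinarith [mul_le_mul_of_nonneg_left h1.1 ha, mul_le_mul_of_nonneg_left h1.2 ha,
    mul_le_mul_of_nonneg_left h2.1 hb, mul_le_mul_of_nonneg_left h2.2 hb]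

end SampleSpace

open SampleSpace

theorem traceInner_eq_sum {n : ℕ} (A B : Matrix (Fin n) (Fin n) ℝ) :
    traceInner A B = ∑ k, ∑ l, A k l * B k l := by
  simp [traceInner, Matrix.trace, Matrix.mul_apply]

theorem dotProduct_mulVec_eq_sum {n : ℕ} (L : Matrix (Fin n) (Fin n) ℝ) (z : Fin n → ℝ) :
    z ⬝ᵥ (L *ᵥ z) = ∑ k, ∑ l, L k l * (z k * z l) := by
  simp only [dotProduct, Matrix.mulVec, Finset.mul_sum]
  exact Finset.sum_congr rfl fun k _ => Finset.sum_congr rfl fun l _ => by ring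

theorem gammaGap_le {n : ℕ} (L : Matrix (Fin n) (Fin n) ℝ) {E : Set ℝ} {z : Fin n → ℝ}
    (hz : ∀ k, z k ∈ E) : gammaGap L E ≤ ((∑ k, ∑ l, L k l * (z k * z l) : ℝ) : EReal) :=
  sInf_le ⟨z, hz, by rw [dotProduct_mulVec_eq_sum]⟩

theorem IsNoncenteredCovariance.symm {X : Type*} {E : Set ℝ} {r : X → X → ℝ}
    (h : IsNoncenteredCovariance E r) (x y : X) : r x y = r y x := by
  obtain ⟨P, -, -, hr⟩ := h
  simp_rw [hr, mul_comm]

/-- A non-centered covariance satisfies the gap inequalities. -/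
theorem IsNoncenteredCovariance.le_sum {X : Type*} {E : Set ℝ} {r : X → X → ℝ}
    (h : IsNoncenteredCovariance E r) {n : ℕ} (L : Matrix (Fin n) (Fin n) ℝ) (x : Fin n → X)
    {c : ℝ} (hc : (c : EReal) ≤ gammaGap L E) : c ≤ ∑ k, ∑ l, L k l * r (x k) (x l) := by
  obtain ⟨P, hP, hLp, hr⟩ := h
  have hint (k l : Fin n) : Integrable (fun ω => L k l * (value (x k) ω * value (x l) ω)) P :=
    ((hLp (x k)).integrable_mul (hLp (x l))).const_mul _
  have hsum : ∑ k, ∑ l, L k l * r (x k) (x l) =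
      ∫ ω, ∑ k, ∑ l, L k l * (value (x k) ω * value (x l) ω) ∂P := by
    rw [integral_finsetSum _ fun k _ => integrable_finsetSum _ fun l _ => hint k l]
    refine Finset.sum_congr rfl fun k _ => ?_
    rw [integral_finsetSum _ fun l _ => hint k l]
    exact Finset.sum_congr rfl fun l _ => by rw [integral_const_mul, hr]
  rw [hsum]
  calc c = ∫ _, c ∂P := by simp
    _ ≤ _ := integral_mono (integrable_const c)
      (integrable_finsetSum _ fun k _ => integrable_finsetSum _ fun l _ => hint k l) fun ω =>
        EReal.coe_le_coe_iff.1 (hc.trans (gammaGap_le L fun k => (ω (x k)).2))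

/-- A matrix satisfying the gap inequalities on `E` belongs to every closed convex set containing
all the products `z zᵀ` with `z` valued in `E`. -/
theorem mem_of_gap_inequalities {n : ℕ} {E : Set ℝ} {R : Fin n → Fin n → ℝ}
    (hsymm : ∀ k l, R k l = R l k)
    (hgap : ∀ L : Matrix (Fin n) (Fin n) ℝ, L.IsSymm →
      gammaGap L E ≤ ((∑ k, ∑ l, L k l * R k l : ℝ) : EReal))
    {D : Set (Fin n → Fin n → ℝ)} (hconv : Convex ℝ D) (hclosed : IsClosed D)
    (hD : ∀ z : Fin n → ℝ, (∀ k, z k ∈ E) → (fun k l => z k * z l) ∈ D) : R ∈ D := by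
  by_contra hR
  obtain ⟨f, u, hfu, huD⟩ := geometric_hahn_banach_point_closed hconv hclosed hR
  set c : Fin n → Fin n → ℝ := fun k l => f (Pi.single k (Pi.single l 1)) with hc
  have hf (A : Fin n → Fin n → ℝ) : f A = ∑ k, ∑ l, c k l * A k l := by
    have hA : A = ∑ k, ∑ l, A k l • (Pi.single k (Pi.single l 1) : Fin n → Fin n → ℝ) := by
      ext i j
      simp [Finset.sum_apply, Pi.single_apply, ite_apply]
    conv_lhs => rw [hA]
    simp only [map_sum, map_smul, smul_eq_mul, hc]
    exact Finset.sum_congr rfl fun k _ => Finset.sum_congr rfl fun l _ => mul_comm _ _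
  -- The gap inequalities are only available for symmetric matrices; symmetrizing the coefficients
  -- of `f` does not change its values on symmetric ones.
  let L : Matrix (Fin n) (Fin n) ℝ := Matrix.of fun k l => (c k l + c l k) / 2
  have hL (A : Fin n → Fin n → ℝ) (hA : ∀ k l, A k l = A l k) :
      ∑ k, ∑ l, L k l * A k l = f A := by
    have hswap : ∑ k, ∑ l, c l k * A k l = ∑ k, ∑ l, c k l * A k l := by
      rw [Finset.sum_comm]
      exact Finset.sum_congr rfl fun k _ => Finset.sum_congr rfl fun l _ => by rw [hA]
    rw [hf]
    calc ∑ k, ∑ l, L k l * A k l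
        = ((∑ k, ∑ l, c k l * A k l) + ∑ k, ∑ l, c l k * A k l) / 2 := by
          simp only [← Finset.sum_add_distrib, Finset.sum_div, L, Matrix.of_apply]
          exact Finset.sum_congr rfl fun k _ => Finset.sum_congr rfl fun l _ => by ring
      _ = _ := by rw [hswap]; ring
  have hLs : L.IsSymm := by
    ext k l
    simp [L, add_comm]
  have hle := hgap L hLs
  rw [hL R hsymm] at hle
  have hu : (u : EReal) ≤ gammaGap L E := by
    refine le_sInf ?_
    rintro v ⟨z, hz, rfl⟩
    rw [dotProduct_mulVec_eq_sum, hL (fun k l => z k * z l) fun k l => mul_comm _ _]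
    exact EReal.coe_le_coe_iff.2 (huD _ (hD z hz)).le
  exact absurd (EReal.coe_le_coe_iff.1 (hu.trans hle)) hfu.not_ge

/-- A bounded set of reals has a finite subset approximating the pairwise products of its
elements. -/
theorem exists_finite_approx_mul {E : Set ℝ} (hE : Bornology.IsBounded E) {ε : ℝ} (hε : 0 < ε) :
    ∃ F ⊆ E, F.Finite ∧ ∃ φ : E → F, ∀ a b : E, |(a : ℝ) * b - φ a * φ b| ≤ ε := by
  obtain ⟨C, hC0, hC⟩ := hE.exists_pos_norm_le
  -- Each factor is bounded by `C`, so rounding both moves a product by at most `2 * C` times the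
  -- radius.
  obtain ⟨F, hFE, hF, hcov⟩ := Metric.finite_approx_of_totallyBounded
    (hE.isCompact_closure.totallyBounded.subset subset_closure) (ε / (2 * C)) (by positivity)
  have hnear (a : E) : ∃ b : F, |(a : ℝ) - (b : ℝ)| ≤ ε / (2 * C) := by
    obtain ⟨b, hb, hab⟩ := Set.mem_iUnion₂.1 (hcov a.2)
    exact ⟨⟨b, hb⟩, le_of_lt hab⟩
  choose φ hφ using hnear
  refine ⟨F, hFE, hF, φ, fun a b => ?_⟩
  have ha : |(a : ℝ)| ≤ C := hC a a.2
  have hb : |(φ b : ℝ)| ≤ C := hC _ (hFE (φ b).2)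
  calc |(a : ℝ) * b - φ a * φ b| = |(a : ℝ) * (b - φ b) + (a - φ a) * φ b| := by ring_nf
    _ ≤ |(a : ℝ)| * |(b : ℝ) - φ b| + |(a : ℝ) - φ a| * |(φ b : ℝ)| := by
      rw [← abs_mul, ← abs_mul]; exact abs_add_le _ _
    _ ≤ C * (ε / (2 * C)) + ε / (2 * C) * C := by gcongr <;> apply hφ
    _ = ε := by field_simp; ring

/-- Under the gap inequalities, `ρ` is approximated uniformly by a non-centered covariance. -/
theorem exists_covariance_near {X : Type*} {E : Set ℝ} (hE : Bornology.IsBounded E)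
    {ρ : X → X → ℝ} (hsymm : ∀ x y, ρ x y = ρ y x)
    (hgap : ∀ n : ℕ, 0 < n → ∀ L : Matrix (Fin n) (Fin n) ℝ, L.IsSymm → ∀ x : Fin n → X,
      gammaGap L E ≤ ((∑ k, ∑ l, L k l * ρ (x k) (x l) : ℝ) : EReal))
    {ε : ℝ} (hε : 0 < ε) :
    ∃ r, IsNoncenteredCovariance E r ∧ ∀ x y, |ρ x y - r x y| ≤ ε := by
  obtain ⟨F, hFE, hF, φ, hφ⟩ := exists_finite_approx_mul hE (half_pos hε)
  have hFb : Bornology.IsBounded F := hE.subset hFE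
  have := compactSpace (X := X) hF.isCompact
  have hne : Nonempty (SampleSpace X F) := by
    rcases isEmpty_or_nonempty X with hX | ⟨⟨x₀⟩⟩
    · exact ⟨fun x => isEmptyElim x⟩
    · rcases E.eq_empty_or_nonempty with rfl | ⟨e, he⟩
      · have h := hgap 1 one_pos 0 (by simp) fun _ => x₀
        have hset : {v : EReal | ∃ z : Fin 1 → ℝ, (∀ k, z k ∈ (∅ : Set ℝ)) ∧
            v = ((z ⬝ᵥ ((0 : Matrix (Fin 1) (Fin 1) ℝ) *ᵥ z) : ℝ) : EReal)} = ∅ := by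
          ext v
          simp
        rw [gammaGap, hset, sInf_empty, top_le_iff] at h
        exact absurd h (EReal.coe_ne_top _)
      · exact ⟨fun _ => φ ⟨e, he⟩⟩
  obtain ⟨ω₀⟩ := hne
  let K : Finset X → Set (ProbabilityMeasure (SampleSpace X F)) := fun s =>
    {P | ∀ x ∈ s, ∀ y ∈ s,
      |ρ x y - ∫ ω, value x ω * value y ω ∂(P : Measure (SampleSpace X F))| ≤ ε}
  have hKclosed (s : Finset X) : IsClosed (K s) := by
    have : K s = ⋂ x ∈ s, ⋂ y ∈ s, {P : ProbabilityMeasure (SampleSpace X F) |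
        |ρ x y - ∫ ω, value x ω * value y ω ∂(P : Measure (SampleSpace X F))| ≤ ε} := by
      ext P
      simp [K]
    rw [this]
    exact isClosed_biInter fun x _ => isClosed_biInter fun y _ => isClosed_le
      (continuous_const.sub (continuous_integral_value_mul_value hFb x y)).abs continuous_const
  have hKne (s : Finset X) : (K s).Nonempty := by
    -- The empty set is treated apart because the gap inequalities assume `0 < n`.
    rcases s.eq_empty_or_nonempty with rfl | hs
    · exact ⟨⟨Measure.dirac ω₀, inferInstance⟩, fun x hx => absurd hx (Finset.notMem_empty x)⟩
    let x : Fin s.card → X := fun k => s.equivFin.symm k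
    have hx : Function.Injective x := Subtype.val_injective.comp s.equivFin.symm.injective
    let D : Set (Fin s.card → Fin s.card → ℝ) :=
      {A | ∃ P : ProbabilityMeasure (SampleSpace X F), ∀ k l,
        |A k l - ∫ ω, value (x k) ω * value (x l) ω ∂(P : Measure (SampleSpace X F))| ≤ ε / 2}
    have hD : Convex ℝ D := convex_setOf_near_covariance hFb x (ε / 2)
    have hmem : (fun k l => ρ (x k) (x l)) ∈ closure D := by
      refine mem_of_gap_inequalities (E := E) (fun k l => hsymm _ _)
        (fun L hL => hgap s.card hs.card_pos L hL x) hD.closure isClosed_closure fun z hz => ?_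
      -- A deterministic field taking the rounded values of `z`; well defined because the points `x
      -- k` are distinct.
      let ω : SampleSpace X F := Function.extend x (fun k => φ ⟨z k, hz k⟩) ω₀
      have hω (k : Fin s.card) : value (x k) ω = φ ⟨z k, hz k⟩ :=
        congrArg Subtype.val (hx.extend_apply (fun k => φ ⟨z k, hz k⟩) ω₀ k)
      refine subset_closure ⟨⟨Measure.dirac ω, inferInstance⟩, fun k l => ?_⟩
      rw [ProbabilityMeasure.coe_mk, integral_dirac' _ _
        (continuous_value_mul_value (x k) (x l)).measurable.stronglyMeasurable, hω, hω]
      exact hφ ⟨z k, hz k⟩ ⟨z l, hz l⟩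
    -- One half of ε pays for rounding, the other for passing to the closure.
    obtain ⟨A, ⟨P, hP⟩, hA⟩ := Metric.mem_closure_iff.1 hmem (ε / 2) (half_pos hε)
    refine ⟨P, fun a ha b hb => ?_⟩
    obtain ⟨k, rfl⟩ : ∃ k, x k = a := ⟨s.equivFin ⟨a, ha⟩, by simp [x]⟩
    obtain ⟨l, rfl⟩ : ∃ l, x l = b := ⟨s.equivFin ⟨b, hb⟩, by simp [x]⟩
    have h1 : |ρ (x k) (x l) - A k l| ≤ ε / 2 :=
      ((dist_le_pi_dist _ _ l).trans (dist_le_pi_dist (fun k l => ρ (x k) (x l)) A k)).trans hA.le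
    calc _ ≤ |ρ (x k) (x l) - A k l| + |A k l - _| := abs_sub_le _ _ _
      _ ≤ ε / 2 + ε / 2 := add_le_add h1 (hP k l)
      _ = ε := add_halves ε
  have hKanti : Antitone K := fun s t hst P hP x hx y hy => hP x (hst hx) y (hst hy)
  obtain ⟨P, hP⟩ := IsCompact.nonempty_iInter_of_directed_nonempty_isCompact_isClosed K
    hKanti.directed_ge hKne (fun s => (hKclosed s).isCompact) hKclosed
  -- The field valued in `F` becomes one valued in `E` by pushforward, with the same covariance.
  have hincl := SampleSpace.continuous_inclusion (X := X) hFE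
  have hprob : IsProbabilityMeasure
      ((P : Measure (SampleSpace X F)).map (SampleSpace.inclusion hFE)) :=
    Measure.isProbabilityMeasure_map hincl.measurable.aemeasurable
  refine ⟨_, ⟨_, hprob, fun x => memLp_value hE _ x 2, fun x y => rfl⟩, fun x y => ?_⟩
  rw [integral_map hincl.measurable.aemeasurable
    (continuous_value_mul_value x y).measurable.aestronglyMeasurable]
  classical
  exact Set.mem_iInter.1 hP {x, y} x (by simp) y (by simp)

theorem theorem2 {X : Type*} (E : Set ℝ) (hE : Bornology.IsBounded E) (ρ : X → X → ℝ) :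
    (∃ r : ℕ → X → X → ℝ, (∀ m, IsNoncenteredCovariance E (r m)) ∧
        ∀ x y, Tendsto (fun m => r m x y) atTop (𝓝 (ρ x y))) ↔
      (∀ x y, ρ x y = ρ y x) ∧
        ∀ n : ℕ, 0 < n → ∀ L : Matrix (Fin n) (Fin n) ℝ, L.IsSymm → ∀ x : Fin n → X,
          gammaGap L E ≤ ((traceInner L (Matrix.of fun k l => ρ (x k) (x l)) : ℝ) : EReal) := by
  simp only [traceInner_eq_sum, Matrix.of_apply]
  constructor
  · rintro ⟨r, hr, hlim⟩
    refine ⟨fun x y => tendsto_nhds_unique (hlim x y) ?_, fun n _ L _ x => ?_⟩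
    · simpa only [fun m => (hr m).symm x y] using hlim y x
    · by_contra! hlt
      -- The gap may be `+∞`, so a real number strictly below it is used instead.
      obtain ⟨c, hc, hcγ⟩ := EReal.lt_iff_exists_real_btwn.1 hlt
      have hsum : Tendsto (fun m => ∑ k, ∑ l, L k l * r m (x k) (x l)) atTop
          (𝓝 (∑ k, ∑ l, L k l * ρ (x k) (x l))) :=
        tendsto_finsetSum _ fun k _ => tendsto_finsetSum _ fun l _ =>
          (hlim (x k) (x l)).const_mul _
      exact absurd (ge_of_tendsto' hsum fun m => (hr m).le_sum L x hcγ.le)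
        (EReal.coe_lt_coe_iff.1 hc).not_ge
  · rintro ⟨hsymm, hgap⟩
    choose r hr hnear using fun m : ℕ =>
      exists_covariance_near hE hsymm hgap (Nat.one_div_pos_of_nat (α := ℝ) (n := m))
    refine ⟨r, hr, fun x y => tendsto_iff_dist_tendsto_zero.2 ?_⟩
    refine squeeze_zero (fun _ => dist_nonneg) (fun m => ?_)
      (tendsto_one_div_add_atTop_nhds_zero_nat (𝕜 := ℝ))
    rw [dist_comm]
    exact hnear m x y
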